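/- Let $D\subset\mathbb C^n$ be a bounded homogeneous domain (a bounded connected open set on which the group of biholomorphic self-maps acts transitively) with $0\in D$, and let $H(D)$ be the space of holomorphic functions $D\to\mathbb C$. Let $K$ be the Bergman kernel of $D$ and let $$H_z(u,\bar u)=\tfrac12\sum_{j,k}\frac{\partial^2\log K(z,z)}{\partial z_j\,\partial\bar z_k}\,u_j\bar u_k$$ be the Bergman metric, normalized so that it equals $|u|^2/(1-|z|^2)^2$ on the unit disk. For $f\in H(D)$ put $$Q_f(z)=\sup_{u\in\mathbb C^n\setminus\{0\}}\frac{\left|\sum_j\frac{\partial f}{\partial z_j}(z)u_j\right|}{H_z(u,\bar u)^{1/2}},\qquad \beta_f=\sup_{z\in D}Q_f(z),\qquad \|f\|_{\mathcal B}=|f(0)|+\beta_f,\qquad \|f\|_\infty=\sup_{z\in D}|f(z)|.$$ Let $\mathcal B(D)=\{f\in H(D):\beta_f<\infty\}$ be the Bloch space and let $$\mathcal B_{0^*}(D)=\{f\in\mathcal B(D): Q_f(z)\to0 \text{ as } z\to\partial^*D\}$$ be the $*$-little Bloch space, both with the norm $\|\cdot\|_{\mathcal B}$. Here $\partial^*D$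 is the distinguished (Shilov) boundary of $D$, that is, the smallest closed subset of $\overline D$ on which every function that is continuous on $\overline D$ and holomorphic on $D$ attains its maximum modulus. For $z\in D$ let $\omega(z)$, respectively $\omega_0(z)$, be the supremum of $|f(z)|$ over all $f\in\mathcal B(D)$, respectively $f\in\mathcal B_{0^*}(D)$, with $f(0)=0$ and $\|f\|_{\mathcal B}\le1$. For $\psi\in H(D)$ put $$\sigma_\psi=\sup_{z\in D}\omega(z)Q_\psi(z),\qquad \sigma_{0,\psi}=\sup_{z\in D}\omega_0(z)Q_\psi(z),$$ and let $M_\psi f=\psi f$. (a) If $M_\psi$ is a bounded operator on $\mathcal B(D)$, then $\sigma_\psi<\infty$ and $$\max\{\|\psi\|_{\mathcal B},\|\psi\|_\infty\}\le\|M_\psi\|\le\max\{\|\psi\|_{\mathcal B},\|\psi\|_\infty+\sigma_\psi\}.$$ (b) If $M_\psi$ is a bounded operator on $\mathcal B_{0^*}(D)$, then $\sigma_{0,\psi}<\infty$ and $$\max\{\|\psi\|_{\mathcal B},\|\psi\|_\infty\}\le\|M_\psi\|\le\max\{\|\psi\|_{\mathcal B},\|\psi\|_\infty+\sigma_{0,\psi}\}.$$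 -/

import Mathlib

open Set Filter Topology MeasureTheory
open scoped ENNReal ComplexConjugate

noncomputable section

namespace BlochMul

/-- The space `ℂⁿ`. Only its topology, linear structure, bounded sets and Lebesgue measure are used,
so the (equivalent) sup norm carried by `Fin n → ℂ` is harmless. -/
abbrev Cn (n : ℕ) : Type := Fin n → ℂ

variable {n : ℕ}

/-- `f` is holomorphic on `D` (for an open set `D` this is `DifferentiableOn ℂ f D`). -/
def IsHolomorphic {F : Type*} [NormedAddCommGroup F] [NormedSpace ℂ F]
    (D : Set (Cn n)) (f : Cn n → F) : Prop :=
  ∀ z ∈ D, DifferentiableAt ℂ f z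

/-! ### Bounded homogeneous domains -/

/-- `φ` restricts to a biholomorphic self-map of `D`. -/
def IsAutomorphism (D : Set (Cn n)) (φ : Cn n → Cn n) : Prop :=
  IsHolomorphic D φ ∧ MapsTo φ D D ∧
    ∃ χ : Cn n → Cn n, IsHolomorphic D χ ∧ MapsTo χ D D ∧ LeftInvOn χ φ D ∧ RightInvOn χ φ D

/-- A bounded domain on which the automorphism group acts transitively. -/
structure IsBoundedHomogeneousDomain (D : Set (Cn n)) : Prop where
  isOpen : IsOpen D
  isConnected : IsConnected D
  isBounded : Bornology.IsBounded D
  transitive : ∀ z ∈ D, ∀ w ∈ D, ∃ φ : Cn n → Cn n, IsAutomorphism D φ ∧ φ z = w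

/-! ### The Bergman kernel and the Bergman metric -/

/-- The Bergman space `A²(D)` of square-integrable holomorphic functions on `D`. -/
def bergmanSpace (D : Set (Cn n)) : Set (Cn n → ℂ) :=
  {f | IsHolomorphic D f ∧ MemLp f 2 (volume.restrict D)}

/-- `k = K(·, w)`: it lies in `A²(D)` and reproduces the value at `w` of each `f` in `A²(D)`. -/
def IsReproducingAt (D : Set (Cn n)) (w : Cn n) (k : Cn n → ℂ) : Prop :=
  k ∈ bergmanSpace D ∧ ∀ f ∈ bergmanSpace D, f w = ∫ ζ in D, f ζ * conj (k ζ)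

open Classical in
/-- The Bergman kernel `K(z, w)` of `D`, the reproducing kernel of `A²(D)`. On a bounded domain,
`K(·, w)` exists for each `w ∈ D` and is determined on `D`. -/
def bergmanKernel (D : Set (Cn n)) (z w : Cn n) : ℂ :=
  if h : ∃ k : Cn n → ℂ, IsReproducingAt D w k then h.choose z else 0

/-- The Wirtinger derivative `∂g/∂z_j = (∂g/∂x_j - i ∂g/∂y_j) / 2`. -/
def wirtinger (j : Fin n) (g : Cn n → ℂ) (z : Cn n) : ℂ :=
  (fderiv ℝ g z (Pi.single j 1) - Complex.I * fderiv ℝ g z (Pi.single j Complex.I)) / 2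

/-- The Wirtinger derivative `∂g/∂z̄_j = (∂g/∂x_j + i ∂g/∂y_j) / 2`. -/
def wirtingerBar (j : Fin n) (g : Cn n → ℂ) (z : Cn n) : ℂ :=
  (fderiv ℝ g z (Pi.single j 1) + Complex.I * fderiv ℝ g z (Pi.single j Complex.I)) / 2

/-- The function `z ↦ log K(z, z)`. -/
def logBergman (D : Set (Cn n)) (z : Cn n) : ℂ :=
  ((Real.log (bergmanKernel D z z).re : ℝ) : ℂ)

/-- The Bergman metric `H_z(u, ū) = (1/2) ∑ j k, ∂²(log K(z, z))/∂z_j∂z̄_k * u_j * ū_k`.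
The factor `1/2` makes it `|u|² / (1 - |z|²)²` on the unit disk. -/
def bergmanMetric (D : Set (Cn n)) (z u : Cn n) : ℝ :=
  (1 / 2) * (∑ j : Fin n, ∑ k : Fin n,
    wirtinger j (wirtingerBar k (logBergman D)) z * u j * conj (u k)).re

/-! ### Bloch functions -/

/-- `Q_f(z)`, the supremum over `u ≠ 0` of `|∇f(z) u| / H_z(u, ū)^(1/2)`. -/
def blochQ (D : Set (Cn n)) (f : Cn n → ℂ) (z : Cn n) : ℝ≥0∞ :=
  ⨆ (u : Cn n) (_ : u ≠ 0), ‖fderiv ℂ f z u‖ₑ / ENNReal.ofReal (Real.sqrt (bergmanMetric D z u))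

/-- `β_f`, the supremum of `Q_f` over `D`. -/
def blochBeta (D : Set (Cn n)) (f : Cn n → ℂ) : ℝ≥0∞ :=
  ⨆ z ∈ D, blochQ D f z

/-- The Bloch norm `|f(0)| + β_f`; it is finite exactly when `β_f` is. -/
def blochENorm (D : Set (Cn n)) (f : Cn n → ℂ) : ℝ≥0∞ :=
  ‖f 0‖ₑ + blochBeta D f

/-- The supremum of `|f|` over `D`. -/
def supENorm (D : Set (Cn n)) (f : Cn n → ℂ) : ℝ≥0∞ :=
  ⨆ z ∈ D, ‖f z‖ₑ

lemma blochQ_zero (D : Set (Cn n)) (z : Cn n) : blochQ D 0 z = 0 := by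
  simp [blochQ]

lemma blochQ_add_le (D : Set (Cn n)) {f g : Cn n → ℂ} {z : Cn n}
    (hf : DifferentiableAt ℂ f z) (hg : DifferentiableAt ℂ g z) :
    blochQ D (f + g) z ≤ blochQ D f z + blochQ D g z := by
  refine iSup₂_le fun u hu => ?_
  rw [fderiv_add hf hg]
  calc _ ≤ (‖fderiv ℂ f z u‖ₑ + ‖fderiv ℂ g z u‖ₑ) /
        ENNReal.ofReal (Real.sqrt (bergmanMetric D z u)) := by
        gcongr
        exact enorm_add_le _ _
    _ = _ := ENNReal.add_div
    _ ≤ _ := add_le_add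
        (le_iSup₂ (f := fun (u : Cn n) (_ : u ≠ 0) => ‖fderiv ℂ f z u‖ₑ /
          ENNReal.ofReal (Real.sqrt (bergmanMetric D z u))) u hu)
        (le_iSup₂ (f := fun (u : Cn n) (_ : u ≠ 0) => ‖fderiv ℂ g z u‖ₑ /
          ENNReal.ofReal (Real.sqrt (bergmanMetric D z u))) u hu)

lemma blochQ_smul (D : Set (Cn n)) {f : Cn n → ℂ} {z : Cn n} (c : ℂ)
    (hf : DifferentiableAt ℂ f z) : blochQ D (c • f) z = ‖c‖ₑ * blochQ D f z := by
  simp only [blochQ, fderiv_const_smul hf, ENNReal.mul_iSup]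
  refine iSup_congr fun u => iSup_congr fun _ => ?_
  rw [smul_apply, smul_eq_mul, enorm_mul, mul_div_assoc]

lemma blochENorm_zero (D : Set (Cn n)) : blochENorm D 0 = 0 := by
  simp [blochENorm, blochBeta, blochQ_zero]

lemma blochENorm_add_le (D : Set (Cn n)) {f g : Cn n → ℂ}
    (hf : IsHolomorphic D f) (hg : IsHolomorphic D g) :
    blochENorm D (f + g) ≤ blochENorm D f + blochENorm D g := by
  have h : blochBeta D (f + g) ≤ blochBeta D f + blochBeta D g :=
    iSup₂_le fun z hz => (blochQ_add_le D (hf z hz) (hg z hz)).trans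
      (add_le_add (le_iSup₂ (f := fun z (_ : z ∈ D) => blochQ D f z) z hz)
        (le_iSup₂ (f := fun z (_ : z ∈ D) => blochQ D g z) z hz))
  calc blochENorm D (f + g) ≤ (‖f 0‖ₑ + ‖g 0‖ₑ) + (blochBeta D f + blochBeta D g) :=
        add_le_add (enorm_add_le _ _) h
    _ = _ := add_add_add_comm _ _ _ _

lemma blochENorm_smul (D : Set (Cn n)) {f : Cn n → ℂ} (c : ℂ) (hf : IsHolomorphic D f) :
    blochENorm D (c • f) = ‖c‖ₑ * blochENorm D f := by
  have h : blochBeta D (c • f) = ‖c‖ₑ * blochBeta D f := by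
    simp only [blochBeta, ENNReal.mul_iSup]
    exact iSup_congr fun z => iSup_congr fun hz => blochQ_smul D c (hf z hz)
  rw [blochENorm, blochENorm, h, mul_add, Pi.smul_apply, smul_eq_mul, enorm_mul]

lemma blochENorm_lt_top_iff (D : Set (Cn n)) (f : Cn n → ℂ) :
    blochENorm D f < ∞ ↔ blochBeta D f < ∞ := by
  simp [blochENorm, ENNReal.add_lt_top]

/-- The Bloch functions on `D`, as a vector space. A function on `D` is represented by its extension
by zero to `ℂⁿ`. -/
def blochSubmodule (D : Set (Cn n)) : Submodule ℂ (Cn n → ℂ) where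
  carrier := {f | IsHolomorphic D f ∧ (∀ z ∉ D, f z = 0) ∧ blochBeta D f < ∞}
  zero_mem' := ⟨fun _ _ => differentiableAt_const _, fun _ _ => rfl, by
    rw [← blochENorm_lt_top_iff, blochENorm_zero]; exact ENNReal.zero_lt_top⟩
  add_mem' := by
    rintro f g ⟨hf, hf0, hfb⟩ ⟨hg, hg0, hgb⟩
    refine ⟨fun z hz => (hf z hz).add (hg z hz), fun z hz => by simp [hf0 z hz, hg0 z hz], ?_⟩
    rw [← blochENorm_lt_top_iff] at *
    exact (blochENorm_add_le D hf hg).trans_lt (ENNReal.add_lt_top.2 ⟨hfb, hgb⟩)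
  smul_mem' := by
    rintro c f ⟨hf, hf0, hfb⟩
    refine ⟨fun z hz => (hf z hz).const_smul c, fun z hz => by simp [hf0 z hz], ?_⟩
    rw [← blochENorm_lt_top_iff] at *
    rw [blochENorm_smul D c hf]
    exact ENNReal.mul_lt_top enorm_lt_top hfb

/-- The Bloch space `𝓑(D)`. It is a separate type, so that its topology is the one of the Bloch norm
and not that of pointwise convergence. -/
def BlochSpace (D : Set (Cn n)) : Type := blochSubmodule D

instance (D : Set (Cn n)) : AddCommGroup (BlochSpace D) :=
  inferInstanceAs (AddCommGroup (blochSubmodule D))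

instance (D : Set (Cn n)) : Module ℂ (BlochSpace D) :=
  inferInstanceAs (Module ℂ (blochSubmodule D))

instance (D : Set (Cn n)) : CoeFun (BlochSpace D) (fun _ => Cn n → ℂ) :=
  ⟨fun f => f.1⟩

/-- The Bloch norm `‖f‖ = |f(0)| + β_f`. -/
instance (D : Set (Cn n)) : Norm (BlochSpace D) :=
  ⟨fun f => (blochENorm D f).toReal⟩

lemma BlochSpace.norm_def {D : Set (Cn n)} (f : BlochSpace D) :
    ‖f‖ = (blochENorm D f).toReal := rfl

lemma BlochSpace.blochENorm_ne_top {D : Set (Cn n)} (f : BlochSpace D) :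
    blochENorm D f ≠ ∞ :=
  ((blochENorm_lt_top_iff D f).2 f.2.2.2).ne

lemma BlochSpace.core (D : Set (Cn n)) : SeminormedSpace.Core ℂ (BlochSpace D) where
  norm_nonneg _ := ENNReal.toReal_nonneg
  norm_smul c f := by
    have h := blochENorm_smul D c f.2.1
    rw [BlochSpace.norm_def, BlochSpace.norm_def]
    change (blochENorm D (c • (f : Cn n → ℂ))).toReal = _
    rw [h, ENNReal.toReal_mul, toReal_enorm]
  norm_triangle f g := by
    rw [BlochSpace.norm_def, BlochSpace.norm_def, BlochSpace.norm_def,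
      ← ENNReal.toReal_add f.blochENorm_ne_top g.blochENorm_ne_top]
    exact ENNReal.toReal_mono
      (ENNReal.add_ne_top.2 ⟨f.blochENorm_ne_top, g.blochENorm_ne_top⟩)
      (blochENorm_add_le D f.2.1 g.2.1)

instance (D : Set (Cn n)) : SeminormedAddCommGroup (BlochSpace D) :=
  SeminormedAddCommGroup.ofCore (BlochSpace.core D)

instance (D : Set (Cn n)) : NormedSpace ℂ (BlochSpace D) where
  norm_smul_le c f := ((BlochSpace.core D).norm_smul c f).le

/-! ### The distinguished boundary and the `*`-little Bloch space -/

/-- `S` is a closed boundary for the algebra `A(D)` of functions continuous on the closure of `D` and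
holomorphic on `D`: each of them attains its maximum modulus on `S`. -/
def IsClosedBoundary (D S : Set (Cn n)) : Prop :=
  IsClosed S ∧ S ⊆ closure D ∧
    ∀ f : Cn n → ℂ, ContinuousOn f (closure D) → IsHolomorphic D f →
      ∀ z ∈ closure D, ∃ w ∈ S, ‖f z‖ ≤ ‖f w‖

/-- The distinguished (Shilov) boundary `∂*D`: the smallest closed boundary for `A(D)`. -/
def distinguishedBoundary (D : Set (Cn n)) : Set (Cn n) :=
  ⋂₀ {S | IsClosedBoundary D S}

/-- The `*`-little Bloch space: the Bloch functions `f` with `Q_f(z) → 0` as `z → ∂*D` within `D`.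
It carries the Bloch norm. -/
def starLittleBloch (D : Set (Cn n)) : Submodule ℂ (BlochSpace D) where
  carrier := {f | Tendsto (blochQ D f) (𝓝ˢ (distinguishedBoundary D) ⊓ 𝓟 D) (𝓝 0)}
  zero_mem' := by
    have h : blochQ D ((0 : BlochSpace D) : Cn n → ℂ) = fun _ => 0 := by
      funext z; exact blochQ_zero D z
    change Tendsto (blochQ D ((0 : BlochSpace D) : Cn n → ℂ)) _ _
    rw [h]
    exact tendsto_const_nhds
  add_mem' := by
    intro f g hf hg
    change Tendsto (blochQ D f) _ _ at hf
    change Tendsto (blochQ D g) _ _ at hg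
    have h := hf.add hg
    rw [add_zero] at h
    refine tendsto_of_tendsto_of_tendsto_of_le_of_le' tendsto_const_nhds h
      (Eventually.of_forall fun _ => zero_le) ?_
    filter_upwards [mem_inf_of_right (mem_principal_self D)] with z hz
    exact blochQ_add_le D (f.2.1 z hz) (g.2.1 z hz)
  smul_mem' := by
    intro c f hf
    change Tendsto (blochQ D f) _ _ at hf
    have h := ENNReal.Tendsto.const_mul (a := ‖c‖ₑ) hf (Or.inr enorm_ne_top)
    rw [mul_zero] at h
    refine h.congr' ?_
    filter_upwards [mem_inf_of_right (mem_principal_self D)] with z hz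
    exact (blochQ_smul D c (f.2.1 z hz)).symm

/-! ### The quantities `ω`, `ω₀`, `σ_ψ`, `σ_{0,ψ}` -/

/-- `ω(z)`: the supremum of `|f(z)|` over `f ∈ 𝓑(D)` with `f(0) = 0` and `‖f‖ ≤ 1`. -/
def omega (D : Set (Cn n)) (z : Cn n) : ℝ≥0∞ :=
  ⨆ (f : BlochSpace D) (_ : f 0 = 0 ∧ ‖f‖ ≤ 1), ‖f z‖ₑ

/-- `ω₀(z)`: the supremum of `|f(z)|` over `f` in the `*`-little Bloch space with `f(0) = 0` and
`‖f‖ ≤ 1`. -/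
def omegaZero (D : Set (Cn n)) (z : Cn n) : ℝ≥0∞ :=
  ⨆ (f : starLittleBloch D) (_ : f.1 0 = 0 ∧ ‖f‖ ≤ 1), ‖f.1 z‖ₑ

/-- `σ_ψ`, the supremum of `ω(z) Q_ψ(z)` over `z ∈ D`. -/
def sigma (D : Set (Cn n)) (ψ : Cn n → ℂ) : ℝ≥0∞ :=
  ⨆ z ∈ D, omega D z * blochQ D ψ z

/-- `σ_{0,ψ}`, the supremum of `ω₀(z) Q_ψ(z)` over `z ∈ D`. -/
def sigmaZero (D : Set (Cn n)) (ψ : Cn n → ℂ) : ℝ≥0∞ :=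
  ⨆ z ∈ D, omegaZero D z * blochQ D ψ z

/-- The bounded operator `T` on `𝓑(D)` is the multiplication operator `M_ψ : f ↦ ψ f`. -/
def IsMulOp (D : Set (Cn n)) (ψ : Cn n → ℂ) (T : BlochSpace D →L[ℂ] BlochSpace D) : Prop :=
  ∀ f : BlochSpace D, ∀ z ∈ D, T f z = ψ z * f z

/-- The bounded operator `T` on the `*`-little Bloch space is the multiplication operator `M_ψ`. -/
def IsStarMulOp (D : Set (Cn n)) (ψ : Cn n → ℂ)
    (T : starLittleBloch D →L[ℂ] starLittleBloch D) : Prop :=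
  ∀ f : starLittleBloch D, ∀ z ∈ D, (T f).1 z = ψ z * f.1 z

end BlochMul

end

/-! Everything rests on the product rule d(ψf) = ψ df + f dψ and on boundedness of point evaluations
in the Bloch norm. If |f(z)| ≤ C‖f‖ for each fixed z, then M_ψ^k 1 = ψ^k gives |ψ(z)|^k ≤ C‖M_ψ‖^k
for all k, hence |ψ(z)| ≤ ‖M_ψ‖. Testing on the constant 1 gives ‖ψ‖_𝓑 ≤ ‖M_ψ‖. Solving the product
rule for f dψ bounds ω Q_ψ by 2‖M_ψ‖. For the upper estimate, f − f(0) has norm β_f, so |f(z)| ≤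
|f(0)| + ω(z) β_f; substituting this in the product rule and collecting the coefficients of |f(0)|
and β_f gives the maximum in the statement.

The analytic work is `exists_norm_apply_le`. It needs the Bergman metric to be locally bounded
above, for which it suffices that log K(z, z) is C² (`contDiffAt_logBergman`). Near a point of D,
evaluation at z on A²(D) is the inner product with a translate of one circular bump function, and
these translates depend smoothly on z in L². Projecting them to A²(D) gives the reproducing kernels,
so K(z, z) is the squared norm of a smooth nonvanishing vector. A local gradient bound and
connectedness of D then control the evaluations.

Both spaces are handled together, as a seminormed space X embedded isometrically in 𝓑(D) with the
constant 1 in its image (`multiplier_norm_estimates`). -/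

namespace BlochMul

/-! ### Smooth dependence of translates on the translation. -/

open BoundedContinuousFunction in
/-- Bounded continuous functions with values in operators, as operators with values in
bounded continuous functions. -/
noncomputable def bcfFlip (X V E : Type*) [TopologicalSpace X] [NormedAddCommGroup V]
    [NormedSpace ℝ V] [NormedAddCommGroup E] [NormedSpace ℝ E] :
    (X →ᵇ (V →L[ℝ] E)) →L[ℝ] V →L[ℝ] (X →ᵇ E) :=
  LinearMap.mkContinuous₂
    (LinearMap.mk₂ ℝ
      (fun F v => (ContinuousLinearMap.apply ℝ E v).compLeftContinuousBounded X F)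
      (fun F G v => by ext; simp) (fun c F v => by ext; simp)
      (fun F v w => by ext; simp) (fun c F v => by ext; simp)) 1
    (fun F v => by
      rw [one_mul]
      refine (BoundedContinuousFunction.norm_le (by positivity)).2 fun x => ?_
      exact ((F x).le_opNorm v).trans (by gcongr; exact F.norm_coe_le_norm x))

/-- The constant does not depend on `y`: this makes the derivative of a translate valid in the sup
norm, not only pointwise. -/
lemma norm_image_sub_sub_fderiv_le {V E : Type*} [NormedAddCommGroup V] [NormedSpace ℝ V]
    [NormedAddCommGroup E] [NormedSpace ℝ E] {χ : V → E} {K : NNReal}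
    (hdiff : Differentiable ℝ χ) (hK : LipschitzWith K (fderiv ℝ χ)) (y h : V) :
    ‖χ (y + h) - χ y - fderiv ℝ χ y h‖ ≤ K * ‖h‖ ^ 2 := by
  have hb : ∀ w ∈ segment ℝ y (y + h), ‖fderiv ℝ χ w - fderiv ℝ χ y‖ ≤ K * ‖h‖ := by
    intro w hw
    rw [← dist_eq_norm]
    refine (hK.dist_le_mul _ _).trans ?_
    gcongr
    rw [dist_eq_norm]
    refine (norm_sub_le_of_mem_segment hw).trans_eq ?_
    rw [add_sub_cancel_left]
  have := (convex_segment y (y + h)).norm_image_sub_le_of_norm_fderiv_le' (fun w _ => hdiff w) hb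
    (left_mem_segment _ _ _) (right_mem_segment _ _ _)
  rw [add_sub_cancel_left] at this
  calc _ ≤ _ := this
    _ = _ := by ring

/-- The translates of a compactly supported smooth function depend smoothly on the translation,
in the norm of uniform convergence. -/
theorem exists_contDiff_translate.{u} {V : Type u} [NormedAddCommGroup V] [NormedSpace ℝ V] (n : ℕ) :
    ∀ {E : Type u} [NormedAddCommGroup E] [NormedSpace ℝ E] (χ : V → E),
      ContDiff ℝ (n + 1) χ → HasCompactSupport χ →
      ∃ T : V → BoundedContinuousFunction V E, (∀ z x, T z x = χ (x - z)) ∧ ContDiff ℝ n T := by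
  -- `E` is quantified inside the induction because the step applies the hypothesis to `fderiv ℝ χ`,
  -- with values in `V →L[ℝ] E`; this is also why `V` and `E` share a universe.
  induction n with
  | zero =>
    intro E _ _ χ hχ hs
    simp only [Nat.cast_zero, zero_add] at hχ
    obtain ⟨C, hC⟩ := hs.exists_bound_of_continuous hχ.continuous
    obtain ⟨K, hK⟩ := ContDiff.lipschitzWith_of_hasCompactSupport hs hχ one_ne_zero
    refine ⟨fun z => .ofNormedAddCommGroup (fun x => χ (x - z))
      (hχ.continuous.comp (continuous_sub_right z)) C fun x => hC _, fun z x => rfl, ?_⟩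
    rw [Nat.cast_zero, contDiff_zero]
    refine (LipschitzWith.of_dist_le_mul (K := K) fun z w => ?_).continuous
    refine (BoundedContinuousFunction.dist_le (by positivity)).2 fun x => ?_
    refine (hK.dist_le_mul _ _).trans_eq ?_
    rw [dist_sub_left]
  | succ n ih =>
    intro E _ _ χ hχ hs
    have hcont := hχ.continuous
    obtain ⟨C, hC⟩ := hs.exists_bound_of_continuous hcont
    have hd : ContDiff ℝ (n + 1) (fderiv ℝ χ) := hχ.fderiv_right (by norm_cast)
    have hds : HasCompactSupport (fderiv ℝ χ) := hs.fderiv ℝ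
    obtain ⟨K, hK⟩ := ContDiff.lipschitzWith_of_hasCompactSupport hds hd (by simp)
    obtain ⟨T', hT', hT'c⟩ := ih (fderiv ℝ χ) hd hds
    have hdiff : Differentiable ℝ χ := hχ.differentiable (by simp)
    refine ⟨fun z => .ofNormedAddCommGroup (fun x => χ (x - z))
      (hcont.comp (continuous_sub_right z)) C fun x => hC _, fun z x => rfl, ?_⟩
    rw [show ((n + 1 : ℕ) : WithTop ℕ∞) = (n : WithTop ℕ∞) + 1 by push_cast; rfl,
      contDiff_succ_iff_hasFDerivAt]
    -- The derivative in `z` of the translate is minus the translate of `fderiv ℝ χ`, which is C^n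
    -- by induction.
    refine ⟨fun z => -bcfFlip V V E (T' z), ((bcfFlip V V E).contDiff.comp hT'c).neg,
      fun z => ?_⟩
    rw [hasFDerivAt_iff_isLittleO_nhds_zero]
    refine Asymptotics.IsBigO.trans_isLittleO (g := fun h : V => ‖h‖ ^ 2) ?_ ?_
    · refine Asymptotics.IsBigO.of_bound K (Eventually.of_forall fun h => ?_)
      rw [Real.norm_of_nonneg (by positivity)]
      refine (BoundedContinuousFunction.norm_le (by positivity)).2 fun x => ?_
      change ‖χ (x - (z + h)) - χ (x - z) - -(T' z x h)‖ ≤ _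
      have h1 := norm_image_sub_sub_fderiv_le hdiff hK (x - z) (-h)
      rw [norm_neg, map_neg, ← hT'] at h1
      rwa [show x - (z + h) = x - z + -h by abel]
    · exact Asymptotics.isLittleO_norm_pow_id one_lt_two

end BlochMul

/-! ### Mean values against circular weights. -/

namespace BlochMul

variable {n : ℕ}

lemma measurePreserving_circle_smul (c : Circle) :
    MeasurePreserving (fun v : Cn n => (c : ℂ) • v) := by
  have h := volume_preserving_pi (ι := Fin n) (α' := fun _ => ℂ) (β' := fun _ => ℂ)
    (f := fun _ => rotation c) (fun _ => (rotation c).measurePreserving)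
  exact h

/-- On a polydisc, a circular weight reproduces the value of a holomorphic function at the
centre. -/
theorem setIntegral_closedBall_circular_mul {f : Cn n → ℂ} {χ : Cn n → ℂ} {z : Cn n} {r : ℝ}
    (hf : ∀ w ∈ Metric.closedBall z r, DifferentiableAt ℂ f w) (hχ : Continuous χ)
    (hc : ∀ (c : Circle) (v : Cn n), χ ((c : ℂ) • v) = χ v) :
    ∫ v in Metric.closedBall 0 r, χ v * f (z + v) =
      (∫ v in Metric.closedBall 0 r, χ v) * f z := by
  set B : Set (Cn n) := Metric.closedBall 0 r
  have hBm : ∀ v ∈ B, ∀ c : ℂ, ‖c‖ ≤ 1 → z + c • v ∈ Metric.closedBall z r := by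
    intro v hv c hc1
    rw [mem_closedBall_zero_iff] at hv
    rw [mem_closedBall_iff_norm, add_sub_cancel_left, norm_smul]
    nlinarith [norm_nonneg v, norm_nonneg c]
  -- The weight, the polydisc and Lebesgue measure are all invariant under `v ↦ e^{iθ} v`. Averaging
  -- over `θ` and exchanging the integrals reduces the claim to the one-variable mean value property
  -- of `c ↦ f (z + c • v)`.
  have hrot : ∀ θ : ℝ, ∫ v in B, χ v * f (z + circleMap 0 1 θ • v) =
      ∫ v in B, χ v * f (z + v) := by
    intro θ
    have hmp := measurePreserving_circle_smul (n := n) (Circle.exp θ)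
    have he : MeasurableEmbedding (fun v : Cn n => ((Circle.exp θ : Circle) : ℂ) • v) :=
      (Homeomorph.smulOfNeZero (α := Cn n) ((Circle.exp θ : Circle) : ℂ)
        (Circle.coe_ne_zero _)).measurableEmbedding
    have h := hmp.setIntegral_preimage_emb he (fun v => χ v * f (z + v)) B
    rw [← h]
    have hpre : (fun v : Cn n => ((Circle.exp θ : Circle) : ℂ) • v) ⁻¹' B = B := by
      ext v; simp [B, norm_smul]
    rw [hpre]
    refine integral_congr_ae (Eventually.of_forall fun v => ?_)
    change χ v * _ = χ _ * _
    rw [hc]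
    simp [circleMap]
  have hmean : ∀ v ∈ B, ∫ θ in (0 : ℝ)..2 * Real.pi, χ v * f (z + circleMap 0 1 θ • v) =
      (2 * Real.pi : ℝ) * (χ v * f z) := by
    intro v hv
    have hd : DiffContOnCl ℂ (fun c : ℂ => f (z + c • v)) (Metric.ball 0 |1|) := by
      apply DifferentiableOn.diffContOnCl
      rw [abs_one, closure_ball _ one_ne_zero]
      intro c hc1
      refine DifferentiableAt.differentiableWithinAt ?_
      refine DifferentiableAt.comp c (hf _ (hBm v hv c (by simpa using hc1))) ?_
      fun_prop
    have h := hd.circleAverage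
    rw [Real.circleAverage_def, zero_smul, add_zero] at h
    rw [intervalIntegral.integral_const_mul, ← h, Complex.real_smul]
    push_cast
    have : (Real.pi : ℂ) ≠ 0 := by exact_mod_cast Real.pi_ne_zero
    field_simp
  have hcont : ContinuousOn (fun p : ℝ × Cn n => χ p.2 * f (z + circleMap 0 1 p.1 • p.2))
      (Icc 0 (2 * Real.pi) ×ˢ B) := by
    refine (hχ.comp continuous_snd).continuousOn.mul ?_
    refine ContinuousOn.comp (t := Metric.closedBall z r)
      (fun w hw => (hf w hw).continuousAt.continuousWithinAt) ?_ ?_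
    · have : Continuous (circleMap 0 1) := continuous_circleMap 0 1
      fun_prop
    · intro p hp
      exact hBm _ hp.2 _ (by simp)
  have hint := (hcont.integrableOn_compact (μ := (volume : Measure ℝ).prod volume)
    (isCompact_Icc.prod (show IsCompact B from isCompact_closedBall 0 r))).mono_set
    (prod_mono_left Ioc_subset_Icc_self)
  rw [IntegrableOn, ← Measure.prod_restrict] at hint
  have hswap := integral_integral_swap (f := fun (θ : ℝ) (v : Cn n) =>
    χ v * f (z + circleMap 0 1 θ • v)) hint
  simp only [hrot] at hswap
  have hR : ∫ v in B, (∫ θ in Ioc 0 (2 * Real.pi), χ v * f (z + circleMap 0 1 θ • v)) =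
      ∫ v in B, (2 * Real.pi : ℝ) * (χ v * f z) := by
    refine setIntegral_congr_fun Metric.isClosed_closedBall.measurableSet fun v hv => ?_
    rw [← intervalIntegral.integral_of_le Real.two_pi_pos.le, hmean v hv]
  rw [hR, integral_const_mul, integral_mul_const, setIntegral_const, Complex.real_smul] at hswap
  have h2 : volume.real (Ioc 0 (2 * Real.pi)) = 2 * Real.pi := by
    simp [Real.pi_pos.le]
  rw [h2] at hswap
  have : ((2 * Real.pi : ℝ) : ℂ) ≠ 0 := by exact_mod_cast Real.two_pi_pos.ne'
  exact mul_left_cancel₀ this hswap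

/-- A smooth circular weight of integral one supported in a small polydisc. -/
theorem exists_circular_bump {r : ℝ} (hr : 0 < r) (N : ℕ) :
    ∃ χ : Cn n → ℂ, ContDiff ℝ N χ ∧ HasCompactSupport χ ∧
      (∀ v, χ v ≠ 0 → ‖v‖ ≤ r) ∧
      (∀ v, conj (χ v) = χ v) ∧
      (∀ (c : Circle) (v : Cn n), χ ((c : ℂ) • v) = χ v) ∧
      ∫ v in Metric.closedBall 0 r, χ v = 1 := by
  -- The squared Euclidean norm is smooth and invariant under the circle, and it dominates the
  -- squared sup norm, so the support lies in the polydisc.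
  set g : Cn n → ℝ := fun v => Real.smoothTransition (1 - ∑ j, Complex.normSq (v j) / r ^ 2)
    with hg
  have hg0 : ∀ v, 0 ≤ g v := fun v => Real.smoothTransition.nonneg _
  have hgs : ContDiff ℝ N g := by
    refine Real.smoothTransition.contDiff.comp (contDiff_const.sub (ContDiff.sum fun j _ => ?_))
    simp only [Complex.normSq_apply]
    have h1 : ContDiff ℝ N (fun v : Cn n => (v j).re) :=
      Complex.reCLM.contDiff.comp (contDiff_apply ℝ ℂ j)
    have h2 : ContDiff ℝ N (fun v : Cn n => (v j).im) :=
      Complex.imCLM.contDiff.comp (contDiff_apply ℝ ℂ j)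
    exact ((h1.mul h1).add (h2.mul h2)).div_const _
  have hsupp : ∀ v, g v ≠ 0 → ‖v‖ ≤ r := by
    intro v hv
    have h1 : 0 < 1 - ∑ j, Complex.normSq (v j) / r ^ 2 := by
      by_contra h
      exact hv (Real.smoothTransition.zero_of_nonpos (not_lt.1 h))
    refine (pi_norm_le_iff_of_nonneg hr.le).2 fun j => ?_
    have h2 : Complex.normSq (v j) / r ^ 2 ≤ ∑ j, Complex.normSq (v j) / r ^ 2 :=
      Finset.single_le_sum (f := fun j => Complex.normSq (v j) / r ^ 2)
        (fun i _ => div_nonneg (Complex.normSq_nonneg _) (by positivity)) (Finset.mem_univ j)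
    have h3 : Complex.normSq (v j) / r ^ 2 ≤ 1 := by linarith
    rw [div_le_one (by positivity), Complex.normSq_eq_norm_sq] at h3
    exact (sq_le_sq₀ (norm_nonneg _) hr.le).1 h3
  have hgc : HasCompactSupport g :=
    HasCompactSupport.intro (isCompact_closedBall 0 r) fun v hv => by
      by_contra h
      exact hv (mem_closedBall_zero_iff.2 (hsupp v h))
  have hpos : 0 < ∫ v, g v := by
    refine hgs.continuous.integral_pos_of_hasCompactSupport_nonneg_nonzero hgc hg0 (x := 0) ?_
    simp [hg]
  have hball : ∫ v in Metric.closedBall 0 r, g v = ∫ v, g v :=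
    setIntegral_eq_integral_of_forall_compl_eq_zero fun v hv => by
      by_contra h
      exact hv (mem_closedBall_zero_iff.2 (hsupp v h))
  refine ⟨fun v => ((g v / ∫ v, g v : ℝ) : ℂ),
    Complex.ofRealCLM.contDiff.comp (hgs.div_const _), ?_, ?_, ?_, ?_, ?_⟩
  · exact hgc.comp_left (g := fun x : ℝ => ((x / ∫ v, g v : ℝ) : ℂ)) (by simp)
  · intro v hv
    refine hsupp v fun h => hv (by simp [h])
  · intro v
    exact Complex.conj_ofReal _
  · intro c v
    simp [hg, Complex.normSq_mul, Circle.normSq_coe]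
  · refine (integral_ofReal (f := fun v => g v / ∫ v, g v)).trans ?_
    rw [integral_div, hball, div_self hpos.ne']
    rfl

end BlochMul

/-! ### The Bergman space in L² and smoothness of log K(z, z). -/

namespace BlochMul

variable {n : ℕ} {D : Set (Cn n)}

/-- Near a point of `D`, the evaluations of holomorphic square-integrable functions are represented
by elements of `L²(D)` that depend smoothly on the point. -/
theorem exists_contDiff_evaluation (hDo : IsOpen D) (hDb : Bornology.IsBounded D) {z₀ : Cn n}
    (hz₀ : z₀ ∈ D) :
    ∃ T : Cn n → Lp ℂ 2 (volume.restrict D), ContDiff ℝ 2 T ∧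
      ∀ᶠ z in 𝓝 z₀, ∀ (f : Cn n → ℂ) (F : Lp ℂ 2 (volume.restrict D)),
        IsHolomorphic D f → f =ᵐ[volume.restrict D] F → f z = inner ℂ (T z) F := by
  have : IsFiniteMeasure (volume.restrict D) := isFiniteMeasure_restrict.2 hDb.measure_lt_top.ne
  obtain ⟨R, hR, hRD⟩ := Metric.isOpen_iff.1 hDo z₀ hz₀
  have hr : 0 < R / 3 := by positivity
  -- Passing to translates costs one derivative, so a C³ bump yields the C² dependence that the
  -- metric needs.
  obtain ⟨χ, hχ, hχc, hχs, hχconj, hχcirc, hχ1⟩ := exists_circular_bump (n := n) hr 3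
  obtain ⟨T, hT, hTc⟩ := exists_contDiff_translate 2 χ (by exact_mod_cast hχ) hχc
  refine ⟨fun z => BoundedContinuousFunction.toLp 2 (volume.restrict D) ℝ (T z),
    (ContinuousLinearMap.contDiff _).comp (by exact_mod_cast hTc), ?_⟩
  filter_upwards [Metric.ball_mem_nhds z₀ hr] with z hz f F hf hfF
  have hsub : Metric.closedBall z (R / 3) ⊆ D := by
    refine Subset.trans (fun w hw => ?_) hRD
    rw [Metric.mem_closedBall] at hw
    rw [Metric.mem_ball] at hz ⊢
    have := dist_triangle w z z₀
    linarith
  have hmv := setIntegral_closedBall_circular_mul (fun w hw => hf w (hsub hw)) hχ.continuous hχcirc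
  rw [hχ1, one_mul] at hmv
  rw [L2.inner_def]
  have h1 : ∫ x in D, inner ℂ
      ((BoundedContinuousFunction.toLp 2 (volume.restrict D) ℝ (T z)) x) (F x) =
      ∫ x in D, χ (x - z) * f x := by
    refine integral_congr_ae ?_
    filter_upwards [hfF, BoundedContinuousFunction.coeFn_toLp 2 (volume.restrict D) ℝ (T z)]
      with x h1 h2
    rw [h2, hT, h1, RCLike.inner_apply, hχconj, mul_comm]
  have h2 : ∫ x in D, χ (x - z) * f x = ∫ x, χ (x - z) * f x := by
    refine setIntegral_eq_integral_of_forall_compl_eq_zero fun x hx => ?_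
    by_contra h
    refine hx (hsub ?_)
    rw [mem_closedBall_iff_norm]
    exact hχs _ (left_ne_zero_of_mul h)
  have h3 : ∫ v in Metric.closedBall 0 (R / 3), χ v * f (z + v) = ∫ v, χ v * f (z + v) := by
    refine setIntegral_eq_integral_of_forall_compl_eq_zero fun x hx => ?_
    by_contra h
    refine hx (mem_closedBall_zero_iff.2 (hχs _ (left_ne_zero_of_mul h)))
  have h4 := integral_add_left_eq_self (μ := (volume : Measure (Cn n)))
    (fun x => χ (x - z) * f x) z
  simp only [add_sub_cancel_left] at h4
  exact hmv.symm.trans (h3.trans (h4.trans (h2.symm.trans h1.symm)))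

/-- The Bergman space as a subspace of `L²(D)`. -/
noncomputable def bergmanLp (D : Set (Cn n)) : Submodule ℂ (Lp ℂ 2 (volume.restrict D)) where
  carrier := {F | ∃ f : Cn n → ℂ, IsHolomorphic D f ∧ f =ᵐ[volume.restrict D] F}
  zero_mem' := ⟨0, fun _ _ => differentiableAt_const _, (Lp.coeFn_zero _ _ _).symm⟩
  add_mem' := by
    rintro F G ⟨f, hf, hfF⟩ ⟨g, hg, hgG⟩
    exact ⟨f + g, fun z hz => (hf z hz).add (hg z hz), (hfF.add hgG).trans (Lp.coeFn_add F G).symm⟩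
  smul_mem' := by
    rintro c F ⟨f, hf, hfF⟩
    exact ⟨c • f, fun z hz => (hf z hz).const_smul c,
      (hfF.const_smul c).trans (Lp.coeFn_smul c F).symm⟩

lemma differentiableAt_complex_of_fderiv_I_smul {E : Type*} [NormedAddCommGroup E]
    [NormedSpace ℂ E] {f : E → ℂ} {z : E} (hf : DifferentiableAt ℝ f z)
    (h : ∀ v, fderiv ℝ f z (Complex.I • v) = Complex.I * fderiv ℝ f z v) :
    DifferentiableAt ℂ f z := by
  refine (differentiableAt_iff_restrictScalars ℝ hf).2
    ⟨{ toFun := fderiv ℝ f z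
       map_add' := map_add _
       map_smul' := fun c v => ?_
       cont := (fderiv ℝ f z).cont }, rfl⟩
  have hc : c • v = c.re • v + c.im • (Complex.I • v) := by
    conv_lhs => rw [← Complex.re_add_im c]
    rw [add_smul, mul_smul, Complex.coe_smul, Complex.coe_smul]
  rw [hc, map_add, map_smul, map_smul, h]
  simp only [Complex.real_smul, RingHom.id_apply, smul_eq_mul]
  conv_rhs => rw [← Complex.re_add_im c]
  ring

/-- The Bergman space is closed in `L²(D)`. -/
theorem isClosed_bergmanLp (hDo : IsOpen D) (hDb : Bornology.IsBounded D) :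
    IsClosed (bergmanLp D : Set (Lp ℂ 2 (volume.restrict D))) := by
  have hex : ∀ z₀, ∃ T : Cn n → Lp ℂ 2 (volume.restrict D), z₀ ∈ D → ContDiff ℝ 2 T ∧
      ∀ᶠ z in 𝓝 z₀, ∀ (f : Cn n → ℂ) (F : Lp ℂ 2 (volume.restrict D)),
        IsHolomorphic D f → f =ᵐ[volume.restrict D] F → f z = inner ℂ (T z) F := by
    intro z₀
    by_cases hz₀ : z₀ ∈ D
    · obtain ⟨T, hT⟩ := exists_contDiff_evaluation hDo hDb hz₀
      exact ⟨T, fun _ => hT⟩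
    · exact ⟨0, fun h => absurd h hz₀⟩
  choose T hT using hex
  refine isClosed_of_closure_subset fun F hF => ?_
  -- Both functionals evaluate Bergman functions at `z`, and an equality of continuous functionals
  -- passes to the closure. So the candidate limit function is locally given by one smooth family.
  have hloc : ∀ z₀ ∈ D, (fun z => inner ℂ (T z z) F) =ᶠ[𝓝 z₀] fun z => inner ℂ (T z₀ z) F := by
    intro z₀ hz₀
    filter_upwards [(hT z₀ hz₀).2, hDo.mem_nhds hz₀] with z hz hzD
    refine closure_minimal (t := {G | inner ℂ (T z z) G = inner ℂ (T z₀ z) G}) ?_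
      (isClosed_eq (by fun_prop) (by fun_prop)) hF
    rintro G ⟨g, hg, hgG⟩
    exact ((hT z hzD).2.self_of_nhds g G hg hgG).symm.trans (hz g G hg hgG)
  refine ⟨fun z => inner ℂ (T z z) F, fun z₀ hz₀ => ?_, ?_⟩
  · refine (Filter.EventuallyEq.differentiableAt_iff (hloc z₀ hz₀)).2 ?_
    have hd : HasFDerivAt (T z₀) (fderiv ℝ (T z₀) z₀) z₀ :=
      ((hT z₀ hz₀).1.differentiable two_ne_zero z₀).hasFDerivAt
    have hG : ∀ G, HasFDerivAt (𝕜 := ℝ) (fun z => inner ℂ (T z₀ z) G) _ z₀ := fun G =>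
      hd.inner ℂ (hasFDerivAt_const G z₀)
    refine differentiableAt_complex_of_fderiv_I_smul (hG F).differentiableAt fun v => ?_
    have hval : ∀ G v, fderiv ℝ (fun z => inner ℂ (T z₀ z) G) z₀ v =
        inner ℂ (fderiv ℝ (T z₀) z₀ v) G := by
      intro G v
      rw [(hG G).fderiv]
      simp
    simp only [hval]
    -- The Cauchy–Riemann equations at `z₀` are a closed condition on `G`, so they too pass to the
    -- limit.
    refine closure_minimal (t := {G | inner ℂ (fderiv ℝ (T z₀) z₀ (Complex.I • v)) G =
      Complex.I * inner ℂ (fderiv ℝ (T z₀) z₀ v) G}) ?_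
      (isClosed_eq (by fun_prop) (by fun_prop)) hF
    rintro G ⟨g, hg, hgG⟩
    have hgT : g =ᶠ[𝓝 z₀] fun z => inner ℂ (T z₀ z) G := by
      filter_upwards [(hT z₀ hz₀).2] with z hz
      exact hz g G hg hgG
    have h1 := ((hg z₀ hz₀).hasFDerivAt.restrictScalars ℝ).fderiv
    rw [mem_ofPred_eq, ← hval, ← hval, ← hgT.fderiv_eq, h1]
    simp
  -- A subsequence converges almost everywhere to `F`, while its holomorphic representatives
  -- converge at every point of `D` to the candidate, by continuity of the inner product.
  · obtain ⟨G, hG, hGF⟩ := mem_closure_iff_seq_limit.1 hF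
    choose g hg hgG using hG
    obtain ⟨s, hsm, hs⟩ := (tendstoInMeasure_of_tendsto_Lp hGF).exists_seq_tendsto_ae
    have hall : ∀ᵐ x ∂volume.restrict D, ∀ k, g k x = G k x := ae_all_iff.2 hgG
    have hsub : Tendsto (fun k => G (s k)) atTop (𝓝 F) := hGF.comp hsm.tendsto_atTop
    filter_upwards [hs, hall, ae_restrict_mem hDo.measurableSet] with x h1 h2 hx
    refine tendsto_nhds_unique ?_ h1
    have h3 : Tendsto (fun k => inner ℂ (T x x) (G (s k))) atTop (𝓝 (inner ℂ (T x x) F)) :=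
      tendsto_const_nhds.inner hsub
    refine h3.congr fun k => ?_
    rw [← (hT x hx).2.self_of_nhds (g (s k)) (G (s k)) (hg _) (hgG _), h2]

lemma toLp_mem_bergmanLp {f : Cn n → ℂ} (hf : f ∈ bergmanSpace D) :
    hf.2.toLp f ∈ bergmanLp D :=
  ⟨f, hf.1, hf.2.coeFn_toLp.symm⟩

lemma inner_toLp_eq_setIntegral {k f : Cn n → ℂ} {G F : Lp ℂ 2 (volume.restrict D)}
    (hk : k =ᵐ[volume.restrict D] G) (hf : f =ᵐ[volume.restrict D] F) :
    inner ℂ G F = ∫ ζ in D, f ζ * conj (k ζ) := by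
  rw [L2.inner_def]
  refine integral_congr_ae ?_
  filter_upwards [hk, hf] with x h1 h2
  rw [h1, h2, RCLike.inner_apply]

/-- An element of the Bergman space that represents the evaluation at `z` gives the value of the
Bergman kernel on the diagonal. -/
lemma bergmanKernel_self_eq_norm_sq {z : Cn n} {G : Lp ℂ 2 (volume.restrict D)}
    (hG : G ∈ bergmanLp D)
    (hGz : ∀ (f : Cn n → ℂ) (F : Lp ℂ 2 (volume.restrict D)),
      IsHolomorphic D f → f =ᵐ[volume.restrict D] F → f z = inner ℂ G F) :
    bergmanKernel D z z = ((‖G‖ ^ 2 : ℝ) : ℂ) := by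
  have hex : ∃ k, IsReproducingAt D z k := by
    obtain ⟨k, hk, hkG⟩ := id hG
    refine ⟨k, ⟨hk, (memLp_congr_ae hkG).2 (Lp.memLp G)⟩, fun f hf => ?_⟩
    rw [hGz f (hf.2.toLp f) hf.1 hf.2.coeFn_toLp.symm,
      inner_toLp_eq_setIntegral hkG hf.2.coeFn_toLp.symm]
  rw [bergmanKernel, dif_pos hex]
  obtain ⟨hk, hrep⟩ := hex.choose_spec
  set k := hex.choose
  set K := hk.2.toLp k
  have hkK : k =ᵐ[volume.restrict D] K := hk.2.coeFn_toLp.symm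
  have hKG : ∀ F ∈ bergmanLp D, inner ℂ K F = inner ℂ G F := by
    rintro F ⟨f, hf, hfF⟩
    rw [← hGz f F hf hfF, hrep f ⟨hf, (memLp_congr_ae hfF).2 (Lp.memLp F)⟩,
      inner_toLp_eq_setIntegral hkK hfF]
  -- Both represent the same functional on the Bergman space and lie in it, so their difference is
  -- orthogonal to itself.
  have hKeq : K = G := by
    have hm : K - G ∈ bergmanLp D := sub_mem (toLp_mem_bergmanLp hk) hG
    rw [← sub_eq_zero, ← inner_self_eq_zero (𝕜 := ℂ), inner_sub_left, hKG _ hm, sub_self]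
  rw [hGz k K hk.1 hkK, hKeq, inner_self_eq_norm_sq_to_K]
  norm_cast

/-- `log K(z, z)` is twice continuously differentiable. -/
theorem contDiffAt_logBergman (hDo : IsOpen D) (hDb : Bornology.IsBounded D) {z₀ : Cn n}
    (hz₀ : z₀ ∈ D) : ContDiffAt ℝ 2 (logBergman D) z₀ := by
  have : IsFiniteMeasure (volume.restrict D) := isFiniteMeasure_restrict.2 hDb.measure_lt_top.ne
  obtain ⟨T, hTc, hT⟩ := exists_contDiff_evaluation hDo hDb hz₀
  have : CompleteSpace (bergmanLp D) := (isClosed_bergmanLp hDo hDb).completeSpace_coe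
  set P := (bergmanLp D).starProjection
  have hPT : ContDiff ℝ 2 fun z => P (T z) := (P.restrictScalars ℝ).contDiff.comp hTc
  have hP : ∀ z, ∀ F ∈ bergmanLp D, inner ℂ (P (T z)) F = inner ℂ (T z) F := fun z F hF => by
    rw [Submodule.inner_starProjection_left_eq_right, Submodule.starProjection_eq_self_iff.2 hF]
  have hK : ∀ᶠ z in 𝓝 z₀, bergmanKernel D z z = ((‖P (T z)‖ ^ 2 : ℝ) : ℂ) := by
    filter_upwards [hT] with z hz
    refine bergmanKernel_self_eq_norm_sq (Submodule.starProjection_apply_mem _ _) ?_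
    intro f F hf hfF
    rw [hz f F hf hfF, hP z F ⟨f, hf, hfF⟩]
  -- The logarithm needs K(z₀, z₀) ≠ 0; the constant 1 lies in A²(D) because D is bounded, and it
  -- does not vanish at `z₀`.
  have hne : P (T z₀) ≠ 0 := by
    intro h0
    have hone : MemLp (fun _ : Cn n => (1 : ℂ)) 2 (volume.restrict D) := memLp_const 1
    have h1 := hT.self_of_nhds (fun _ => 1) (hone.toLp _) (fun _ _ => differentiableAt_const _)
      hone.coeFn_toLp.symm
    rw [← hP z₀ _ ⟨_, fun _ _ => differentiableAt_const _, hone.coeFn_toLp.symm⟩, h0,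
      inner_zero_left] at h1
    exact one_ne_zero h1
  have hlog : logBergman D =ᶠ[𝓝 z₀] fun z => ((Real.log (‖P (T z)‖ ^ 2) : ℝ) : ℂ) := by
    filter_upwards [hK] with z hz
    rw [logBergman, hz, Complex.ofReal_re]
  refine ContDiffAt.congr_of_eventuallyEq ?_ hlog
  refine Complex.ofRealCLM.contDiff.contDiffAt.comp z₀ ?_
  exact ((hPT.norm_sq ℂ).contDiffAt).log (by positivity)

/-! ### Local upper bounds for the Bergman metric. -/

lemma contDiffAt_wirtingerBar {g : Cn n → ℂ} {z : Cn n} {m k : WithTop ℕ∞}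
    (hg : ContDiffAt ℝ m g z) (hk : k + 1 ≤ m) (j : Fin n) :
    ContDiffAt ℝ k (wirtingerBar j g) z := by
  have h := hg.fderiv_right hk
  exact ((h.clm_apply contDiffAt_const).add
    (contDiffAt_const.mul (h.clm_apply contDiffAt_const))).div_const _

lemma contDiffAt_wirtinger {g : Cn n → ℂ} {z : Cn n} {m k : WithTop ℕ∞}
    (hg : ContDiffAt ℝ m g z) (hk : k + 1 ≤ m) (j : Fin n) :
    ContDiffAt ℝ k (wirtinger j g) z := by
  have h := hg.fderiv_right hk
  exact ((h.clm_apply contDiffAt_const).sub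
    (contDiffAt_const.mul (h.clm_apply contDiffAt_const))).div_const _

/-- The Bergman metric is locally bounded. -/
theorem exists_bergmanMetric_le (hDo : IsOpen D) (hDb : Bornology.IsBounded D) {z₀ : Cn n}
    (hz₀ : z₀ ∈ D) :
    ∃ M : ℝ, 0 ≤ M ∧ ∀ᶠ z in 𝓝 z₀, ∀ u, bergmanMetric D z u ≤ M * ‖u‖ ^ 2 := by
  set c : Fin n → Fin n → Cn n → ℂ := fun j k => wirtinger j (wirtingerBar k (logBergman D))
  have hc : ∀ j k, ContinuousAt (c j k) z₀ := fun j k =>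
    (contDiffAt_wirtinger (k := 0) (contDiffAt_wirtingerBar (k := 1)
      (contDiffAt_logBergman hDo hDb hz₀) one_add_one_eq_two.le k) (by simp) j).continuousAt
  have hS : ContinuousAt (fun z => ∑ j, ∑ k, ‖c j k z‖) z₀ :=
    tendsto_finsetSum _ fun j _ => tendsto_finsetSum _ fun k _ => (hc j k).norm
  refine ⟨(∑ j, ∑ k, ‖c j k z₀‖) + 1, by positivity, ?_⟩
  filter_upwards [hS.eventually_lt continuousAt_const (lt_add_one _)] with z hz u
  have h1 : ‖∑ j, ∑ k, c j k z * u j * conj (u k)‖ ≤ (∑ j, ∑ k, ‖c j k z‖) * ‖u‖ ^ 2 := by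
    simp only [Finset.sum_mul]
    refine norm_sum_le_of_le _ fun j _ => norm_sum_le_of_le _ fun k _ => ?_
    rw [norm_mul, norm_mul, RCLike.norm_conj, sq, mul_assoc]
    gcongr <;> exact norm_le_pi_norm u _
  have h2 := (Complex.abs_re_le_norm _).trans h1
  have h3 := (le_abs_self _).trans h2
  have h4 : (∑ j, ∑ k, ‖c j k z‖) * ‖u‖ ^ 2 ≤ ((∑ j, ∑ k, ‖c j k z₀‖) + 1) * ‖u‖ ^ 2 := by
    gcongr
  have h5 : 0 ≤ ((∑ j, ∑ k, ‖c j k z₀‖) + 1) * ‖u‖ ^ 2 := by positivity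
  rw [bergmanMetric]
  change 1 / 2 * (∑ j, ∑ k, c j k z * u j * conj (u k)).re ≤ _
  linarith

/-! ### Point evaluations on the Bloch space -/

lemma blochQ_le_blochBeta {f : Cn n → ℂ} {z : Cn n} (hz : z ∈ D) : blochQ D f z ≤ blochBeta D f :=
  le_iSup₂ (f := fun z (_ : z ∈ D) => blochQ D f z) z hz

lemma BlochSpace.ofReal_norm (f : BlochSpace D) : ENNReal.ofReal ‖f‖ = blochENorm D f :=
  ENNReal.ofReal_toReal f.blochENorm_ne_top

lemma BlochSpace.blochQ_le (f : BlochSpace D) {z : Cn n} (hz : z ∈ D) :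
    blochQ D f z ≤ ENNReal.ofReal ‖f‖ :=
  (blochQ_le_blochBeta hz).trans (le_add_self.trans f.ofReal_norm.ge)

/-- No positivity of the metric is needed: if the square root is 0, finiteness of the quotient in
`ℝ≥0∞` forces the numerator to vanish. -/
lemma BlochSpace.norm_fderiv_apply_le (f : BlochSpace D) {z : Cn n} (hz : z ∈ D) (u : Cn n) :
    ‖fderiv ℂ f z u‖ ≤ ‖f‖ * Real.sqrt (bergmanMetric D z u) := by
  rcases eq_or_ne u 0 with rfl | hu
  · rw [map_zero, norm_zero]; positivity
  have h1 : ‖fderiv ℂ f z u‖ₑ / ENNReal.ofReal (Real.sqrt (bergmanMetric D z u)) ≤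
      ENNReal.ofReal ‖f‖ :=
    (le_iSup₂ (f := fun (u : Cn n) (_ : u ≠ 0) => ‖fderiv ℂ f z u‖ₑ /
      ENNReal.ofReal (Real.sqrt (bergmanMetric D z u))) u hu).trans (f.blochQ_le hz)
  rw [ENNReal.div_le_iff_le_mul (Or.inr ENNReal.ofReal_ne_top) (Or.inl ENNReal.ofReal_ne_top),
    ← ENNReal.ofReal_mul (norm_nonneg f), ← _root_.ofReal_norm,
    ENNReal.ofReal_le_ofReal_iff (by positivity)] at h1
  exact h1

/-- Bloch functions are locally Lipschitz, uniformly on the unit ball of the Bloch space. -/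
lemma exists_eventually_norm_sub_le (hDo : IsOpen D) (hDb : Bornology.IsBounded D) {z₀ : Cn n}
    (hz₀ : z₀ ∈ D) :
    ∃ C : ℝ, ∀ᶠ z in 𝓝 z₀, ∀ f : BlochSpace D, ‖f z - f z₀‖ ≤ C * ‖f‖ := by
  obtain ⟨M, hM0, hM⟩ := exists_bergmanMetric_le hDo hDb hz₀
  obtain ⟨r, hr, hball⟩ := Metric.eventually_nhds_iff_ball.1 (hM.and (hDo.mem_nhds hz₀))
  refine ⟨Real.sqrt M * r, ?_⟩
  filter_upwards [Metric.ball_mem_nhds z₀ hr] with z hz f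
  have hb : ∀ w ∈ Metric.ball z₀ r, ‖fderiv ℂ f w‖ ≤ ‖f‖ * Real.sqrt M := by
    intro w hw
    refine ContinuousLinearMap.opNorm_le_bound _ (by positivity) fun u => ?_
    refine (f.norm_fderiv_apply_le (hball w hw).2 u).trans ?_
    rw [mul_assoc]
    gcongr
    refine (Real.sqrt_le_sqrt ((hball w hw).1 u)).trans_eq ?_
    rw [Real.sqrt_mul hM0, Real.sqrt_sq (norm_nonneg u)]
  have h := (convex_ball z₀ r).norm_image_sub_le_of_norm_fderiv_le (𝕜 := ℂ)
    (fun w hw => f.2.1 w (hball w hw).2) hb (Metric.mem_ball_self hr) hz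
  refine h.trans ?_
  rw [Metric.mem_ball, dist_eq_norm] at hz
  calc ‖f‖ * Real.sqrt M * ‖z - z₀‖ ≤ ‖f‖ * Real.sqrt M * r := by gcongr
    _ = _ := by ring

/-- Point evaluations are bounded on the Bloch space. -/
theorem exists_norm_apply_le (hD : IsBoundedHomogeneousDomain D) (h0 : (0 : Cn n) ∈ D) {z : Cn n}
    (hz : z ∈ D) : ∃ C : ℝ, ∀ f : BlochSpace D, ‖f z‖ ≤ C * ‖f‖ := by
  have hdiff : ∃ C : ℝ, ∀ f : BlochSpace D, ‖f z - f 0‖ ≤ C * ‖f‖ := by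
    -- Having a difference of evaluations bounded by a multiple of the norm is an equivalence
    -- relation between points, and it holds between each point and its neighbours; connectedness
    -- makes it hold throughout `D`.
    refine hD.isConnected.isPreconnected.induction₂'
      (fun x y => ∃ C : ℝ, ∀ f : BlochSpace D, ‖f y - f x‖ ≤ C * ‖f‖) ?_ ?_ h0 hz
    · intro x hx
      obtain ⟨C, hC⟩ := exists_eventually_norm_sub_le hD.isOpen hD.isBounded hx
      filter_upwards [nhdsWithin_le_nhds hC] with y hy
      exact ⟨⟨C, hy⟩, ⟨C, fun f => (norm_sub_rev _ _).trans_le (hy f)⟩⟩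
    · rintro x y w - - - ⟨C, hC⟩ ⟨C', hC'⟩
      refine ⟨C + C', fun f => ?_⟩
      have := norm_sub_le_norm_sub_add_norm_sub (f w) (f y) (f x)
      linarith [hC f, hC' f]
  obtain ⟨C, hC⟩ := hdiff
  refine ⟨C + 1, fun f => ?_⟩
  have h1 : ‖f 0‖ ≤ ‖f‖ := by
    have h : ‖f 0‖ₑ ≤ ENNReal.ofReal ‖f‖ := le_self_add.trans f.ofReal_norm.ge
    rwa [← _root_.ofReal_norm, ENNReal.ofReal_le_ofReal_iff (norm_nonneg f)] at h
  have h2 := norm_le_norm_add_norm_sub' (f z) (f 0)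
  linarith [hC f]

/-! ### The product rule for `Q` -/

lemma blochQ_le_of_fderiv {f g h : Cn n → ℂ} {z : Cn n} {a b : ℝ≥0∞}
    (H : ∀ u, ‖fderiv ℂ f z u‖ₑ ≤ a * ‖fderiv ℂ g z u‖ₑ + b * ‖fderiv ℂ h z u‖ₑ) :
    blochQ D f z ≤ a * blochQ D g z + b * blochQ D h z := by
  refine iSup₂_le fun u hu => (ENNReal.div_le_div_right (H u) _).trans ?_
  rw [ENNReal.add_div, mul_div_assoc, mul_div_assoc]
  gcongr
  · exact le_iSup₂ (f := fun (u : Cn n) (_ : u ≠ 0) => ‖fderiv ℂ g z u‖ₑ /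
      ENNReal.ofReal (Real.sqrt (bergmanMetric D z u))) u hu
  · exact le_iSup₂ (f := fun (u : Cn n) (_ : u ≠ 0) => ‖fderiv ℂ h z u‖ₑ /
      ENNReal.ofReal (Real.sqrt (bergmanMetric D z u))) u hu

lemma blochQ_congr {f g : Cn n → ℂ} (hDo : IsOpen D) (h : EqOn f g D) {z : Cn n} (hz : z ∈ D) :
    blochQ D f z = blochQ D g z := by
  have : f =ᶠ[𝓝 z] g := h.eventuallyEq_of_mem (hDo.mem_nhds hz)
  simp only [blochQ, this.fderiv_eq]

lemma blochBeta_congr {f g : Cn n → ℂ} (hDo : IsOpen D) (h : EqOn f g D) :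
    blochBeta D f = blochBeta D g :=
  iSup_congr fun _ => iSup_congr fun hz => blochQ_congr hDo h hz

lemma blochQ_mul_le {ψ f : Cn n → ℂ} {z : Cn n} (hψ : DifferentiableAt ℂ ψ z)
    (hf : DifferentiableAt ℂ f z) :
    blochQ D (ψ * f) z ≤ ‖ψ z‖ₑ * blochQ D f z + ‖f z‖ₑ * blochQ D ψ z := by
  refine blochQ_le_of_fderiv fun u => ?_
  rw [fderiv_mul hψ hf]
  refine (enorm_add_le _ _).trans_eq ?_
  simp [enorm_mul]

/-- The product rule solved for f dψ, with `f z` frozen as a scalar. -/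
lemma enorm_mul_blochQ_le {ψ f : Cn n → ℂ} {z : Cn n} (hψ : DifferentiableAt ℂ ψ z)
    (hf : DifferentiableAt ℂ f z) :
    ‖f z‖ₑ * blochQ D ψ z ≤ blochQ D (ψ * f) z + ‖ψ z‖ₑ * blochQ D f z := by
  rw [← blochQ_smul D (f z) hψ, ← one_mul (blochQ D (ψ * f) z)]
  refine blochQ_le_of_fderiv fun u => ?_
  rw [fderiv_mul hψ hf, fderiv_const_smul hψ, one_mul]
  have : (f z • fderiv ℂ ψ z) u =
      (ψ z • fderiv ℂ f z + f z • fderiv ℂ ψ z) u - ψ z * fderiv ℂ f z u := by simp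
  rw [this, ← enorm_mul]
  exact enorm_sub_le

/-! ### Constants -/

lemma blochQ_indicator_one (hDo : IsOpen D) {z : Cn n} (hz : z ∈ D) :
    blochQ D (D.indicator fun _ => 1) z = 0 := by
  rw [blochQ_congr hDo (eqOn_indicator (f := fun _ => (1 : ℂ))) hz]
  simp [blochQ]

lemma blochBeta_indicator_one (hDo : IsOpen D) : blochBeta D (D.indicator fun _ => 1) = 0 := by
  simp +contextual [blochBeta, blochQ_indicator_one hDo]

/-- The constant function one, as a Bloch function. -/
noncomputable def blochOne (hDo : IsOpen D) : BlochSpace D :=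
  ⟨D.indicator fun _ => 1,
    fun z hz => (differentiableAt_const (1 : ℂ)).congr_of_eventuallyEq
      ((eqOn_indicator (f := fun _ => (1 : ℂ))).eventuallyEq_of_mem (hDo.mem_nhds hz)),
    fun _ hz => indicator_of_notMem hz _,
    by rw [blochBeta_indicator_one hDo]; exact ENNReal.zero_lt_top⟩

lemma blochOne_apply (hDo : IsOpen D) {z : Cn n} (hz : z ∈ D) : blochOne hDo z = 1 :=
  indicator_of_mem (f := fun _ => (1 : ℂ)) hz

lemma blochBeta_blochOne (hDo : IsOpen D) : blochBeta D (blochOne hDo) = 0 :=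
  blochBeta_indicator_one hDo

lemma norm_blochOne (hDo : IsOpen D) (h0 : (0 : Cn n) ∈ D) : ‖blochOne hDo‖ = 1 := by
  rw [BlochSpace.norm_def, blochENorm, blochBeta_blochOne, blochOne_apply hDo h0]
  simp

lemma blochOne_mem_starLittleBloch (hDo : IsOpen D) : blochOne hDo ∈ starLittleBloch D := by
  refine Tendsto.congr' (f₁ := fun _ => 0) ?_ tendsto_const_nhds
  filter_upwards [mem_inf_of_right (mem_principal_self D)] with z hz
  exact (blochQ_indicator_one hDo hz).symm

/-- This removes the evaluation constant `C`: otherwise (a/b)^k would be unbounded. -/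
lemma le_of_pow_le_const_mul_pow {a b C : ℝ} (hb : 0 ≤ b)
    (h : ∀ k : ℕ, a ^ k ≤ C * b ^ k) : a ≤ b := by
  rcases hb.eq_or_lt with rfl | hb
  · simpa using h 1
  by_contra! hab
  obtain ⟨k, hk⟩ := pow_unbounded_of_one_lt C ((one_lt_div hb).2 hab)
  rw [div_pow, lt_div_iff₀ (by positivity)] at hk
  exact (h k).not_gt hk

/-! ### Norm estimates for multipliers, for both Bloch spaces at once. -/

section Multiplier

variable {X : Type*} [SeminormedAddCommGroup X] [NormedSpace ℂ X] {ι : X →ₗᵢ[ℂ] BlochSpace D}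
  {ψ : Cn n → ℂ} {T : X →L[ℂ] X}

lemma ofReal_norm_eq_blochENorm (ι : X →ₗᵢ[ℂ] BlochSpace D) (x : X) :
    ENNReal.ofReal ‖x‖ = blochENorm D (ι x) := by
  rw [← (ι x).ofReal_norm, ι.norm_map]

lemma multiplier_pow_apply (hT : ∀ x, ∀ z ∈ D, ι (T x) z = ψ z * ι x z) (k : ℕ) (x : X)
    {z : Cn n} (hz : z ∈ D) : ι ((T ^ k) x) z = ψ z ^ k * ι x z := by
  induction k with
  | zero => simp
  | succ k ih => rw [pow_succ', mul_apply_eq_comp, hT _ z hz, ih, pow_succ', mul_assoc]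

/-- The symbol of a bounded multiplication operator is bounded by the norm of the operator. -/
lemma supENorm_le_opNorm (hD : IsBoundedHomogeneousDomain D) (h0 : (0 : Cn n) ∈ D) {e : X}
    (he : ι e = blochOne hD.isOpen) (hT : ∀ x, ∀ z ∈ D, ι (T x) z = ψ z * ι x z) :
    supENorm D ψ ≤ ENNReal.ofReal ‖T‖ := by
  refine iSup₂_le fun z hz => ?_
  rw [← _root_.ofReal_norm]
  refine ENNReal.ofReal_le_ofReal ?_
  obtain ⟨C, hC⟩ := exists_norm_apply_le hD h0 hz
  have hC0 : 0 ≤ C := by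
    have := (norm_nonneg _).trans (hC (blochOne hD.isOpen))
    rwa [norm_blochOne _ h0, mul_one] at this
  have hen : ‖e‖ = 1 := by rw [← ι.norm_map, he, norm_blochOne _ h0]
  refine le_of_pow_le_const_mul_pow (norm_nonneg _) (C := C) fun k => ?_
  have h1 := hC (ι ((T ^ k) e))
  rw [multiplier_pow_apply hT k e hz, he, blochOne_apply _ hz, mul_one, norm_pow,
    ι.norm_map] at h1
  refine h1.trans ?_
  gcongr
  have h2 : ∀ k : ℕ, ‖(T ^ k) e‖ ≤ ‖T‖ ^ k := by
    intro k
    induction k with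
    | zero => simp [hen]
    | succ k ih =>
      rw [pow_succ', mul_apply_eq_comp, pow_succ']
      exact (T.le_opNorm _).trans (by gcongr)
  exact h2 k

lemma blochENorm_le_opNorm (hDo : IsOpen D) (h0 : (0 : Cn n) ∈ D) {e : X}
    (he : ι e = blochOne hDo) (hT : ∀ x, ∀ z ∈ D, ι (T x) z = ψ z * ι x z) :
    blochENorm D ψ ≤ ENNReal.ofReal ‖T‖ := by
  have hE : EqOn (ι (T e)) ψ D := fun z hz => by
    rw [hT e z hz, he, blochOne_apply _ hz, mul_one]
  have h1 : blochENorm D ψ = blochENorm D (ι (T e)) := by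
    rw [blochENorm, blochENorm, blochBeta_congr hDo hE, hE h0]
  have hen : ‖e‖ = 1 := by rw [← ι.norm_map, he, norm_blochOne _ h0]
  rw [h1, ← ofReal_norm_eq_blochENorm]
  refine ENNReal.ofReal_le_ofReal ?_
  simpa [hen] using T.le_opNorm e

/-- The supremum of `‖f z‖` over the functions `f` of norm at most one in the range of `ι` that
vanish at `0`. -/
noncomputable def growth (ι : X →ₗᵢ[ℂ] BlochSpace D) (z : Cn n) : ℝ≥0∞ :=
  ⨆ (x : X) (_ : ι x 0 = 0 ∧ ‖x‖ ≤ 1), ‖ι x z‖ₑ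

lemma iSup_growth_mul_blochQ_le (hD : IsBoundedHomogeneousDomain D)
    (hψ : IsHolomorphic D ψ) (hsup : supENorm D ψ ≤ ENNReal.ofReal ‖T‖)
    (hT : ∀ x, ∀ z ∈ D, ι (T x) z = ψ z * ι x z) :
    ⨆ z ∈ D, growth ι z * blochQ D ψ z ≤ ENNReal.ofReal ‖T‖ + ENNReal.ofReal ‖T‖ := by
  refine iSup₂_le fun z hz => ?_
  rw [growth, ENNReal.iSup_mul]
  refine iSup_le fun x => ?_
  rw [ENNReal.iSup_mul]
  refine iSup_le fun hx => ?_
  have hQ : ∀ y : X, blochQ D (ι y) z ≤ ENNReal.ofReal ‖y‖ := fun y => by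
    rw [← ι.norm_map]; exact (ι y).blochQ_le hz
  have hE : EqOn (ψ * (ι x : Cn n → ℂ)) (ι (T x)) D := fun w hw => (hT x w hw).symm
  refine (enorm_mul_blochQ_le (hψ z hz) ((ι x).2.1 z hz)).trans (add_le_add ?_ ?_)
  · rw [blochQ_congr hD.isOpen hE hz]
    refine (hQ _).trans (ENNReal.ofReal_le_ofReal ?_)
    exact (T.le_opNorm_of_le hx.2).trans_eq (mul_one _)
  · have h1 : ‖ψ z‖ₑ ≤ ENNReal.ofReal ‖T‖ :=
      (le_iSup₂ (f := fun z (_ : z ∈ D) => ‖ψ z‖ₑ) z hz).trans hsup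
    have h2 : blochQ D (ι x) z ≤ 1 :=
      (hQ x).trans (ENNReal.ofReal_le_one.2 hx.2)
    exact (mul_le_mul' h1 h2).trans_eq (mul_one _)

lemma enorm_apply_le_growth_mul (hD : IsBoundedHomogeneousDomain D) (h0 : (0 : Cn n) ∈ D)
    {y : X} (hy : ι y 0 = 0) {z : Cn n} (hz : z ∈ D) :
    ‖ι y z‖ₑ ≤ growth ι z * ENNReal.ofReal ‖y‖ := by
  -- `X` is only seminormed, so `‖y‖ = 0` does not give `y = 0`; boundedness of evaluations still
  -- gives the value 0 at `z`. Otherwise `y` is normalized.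
  rcases (norm_nonneg y).eq_or_lt with h | h
  · obtain ⟨C, hC⟩ := exists_norm_apply_le hD h0 hz
    have h1 := hC (ι y)
    rw [ι.norm_map, ← h, mul_zero] at h1
    rw [norm_le_zero_iff.1 h1, enorm_zero]
    exact zero_le
  · set c : ℂ := ((‖y‖⁻¹ : ℝ) : ℂ)
    have hcn : ‖c‖ = ‖y‖⁻¹ := by simp [c]
    have happ : ∀ w, ι (c • y) w = c * ι y w := fun w => by rw [map_smul]; rfl
    have h1 : ‖ι (c • y) z‖ₑ ≤ growth ι z :=
      le_iSup₂ (f := fun (x : X) (_ : ι x 0 = 0 ∧ ‖x‖ ≤ 1) => ‖ι x z‖ₑ) (c • y)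
        ⟨by rw [happ, hy, mul_zero], by rw [norm_smul, hcn, inv_mul_cancel₀ h.ne']⟩
    rw [happ, enorm_mul, ← _root_.ofReal_norm c, hcn, ENNReal.ofReal_inv_of_pos h, mul_comm,
      ← div_eq_mul_inv] at h1
    exact (ENNReal.div_le_iff_le_mul (Or.inl (ENNReal.ofReal_pos.2 h).ne')
      (Or.inl ENNReal.ofReal_ne_top)).1 h1

lemma ofReal_opNorm_le (hD : IsBoundedHomogeneousDomain D) (h0 : (0 : Cn n) ∈ D)
    (hψ : IsHolomorphic D ψ) {e : X} (he : ι e = blochOne hD.isOpen)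
    (hT : ∀ x, ∀ z ∈ D, ι (T x) z = ψ z * ι x z) :
    ENNReal.ofReal ‖T‖ ≤
      max (blochENorm D ψ) (supENorm D ψ + ⨆ z ∈ D, growth ι z * blochQ D ψ z) := by
  set S := ⨆ z ∈ D, growth ι z * blochQ D ψ z
  set M := max (blochENorm D ψ) (supENorm D ψ + S)
  rcases eq_or_ne M ∞ with hM | hM
  · rw [hM]; exact le_top
  rw [ENNReal.ofReal_le_iff_le_toReal hM]
  refine T.opNorm_le_bound ENNReal.toReal_nonneg fun x => ?_
  rw [← ENNReal.ofReal_le_ofReal_iff (by positivity), ENNReal.ofReal_mul ENNReal.toReal_nonneg,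
    ENNReal.ofReal_toReal hM, ofReal_norm_eq_blochENorm ι, ofReal_norm_eq_blochENorm ι]
  set a := ι x 0
  -- Removing the value at 0 leaves the derivative unchanged, so `‖y‖` is exactly the seminorm β of
  -- `ι x`, and `growth` applies to `y`.
  set y := x - a • e
  have hya : ∀ w ∈ D, ι y w = ι x w - a := by
    intro w hw
    rw [map_sub, map_smul, he]
    change ι x w - a * blochOne hD.isOpen w = _
    rw [blochOne_apply _ hw, mul_one]
  have hy0 : ι y 0 = 0 := by rw [hya 0 h0, sub_self]
  have hyβ : ENNReal.ofReal ‖y‖ = blochBeta D (ι x) := by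
    rw [ofReal_norm_eq_blochENorm ι, blochENorm, hy0, enorm_zero, zero_add]
    refine iSup_congr fun z => iSup_congr fun hz => ?_
    rw [blochQ_congr (g := fun w => ι x w - a) hD.isOpen hya hz]
    simp only [blochQ, fderiv_sub_const]
  have hval : ∀ z ∈ D, ‖ι x z‖ₑ ≤ ‖a‖ₑ + growth ι z * blochBeta D (ι x) := by
    intro z hz
    rw [← hyβ, show ι x z = a + ι y z by rw [hya z hz]; ring]
    exact (enorm_add_le _ _).trans (by gcongr; exact enorm_apply_le_growth_mul hD h0 hy0 hz)
  have hE : EqOn (ι (T x)) (ψ * (ι x : Cn n → ℂ)) D := fun w hw => hT x w hw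
  have hβ : blochBeta D (ι (T x)) ≤
      supENorm D ψ * blochBeta D (ι x) + (‖a‖ₑ * blochBeta D ψ + S * blochBeta D (ι x)) := by
    refine iSup₂_le fun z hz => ?_
    rw [blochQ_congr hD.isOpen hE hz]
    refine (blochQ_mul_le (hψ z hz) ((ι x).2.1 z hz)).trans (add_le_add ?_ ?_)
    · exact mul_le_mul' (le_iSup₂ (f := fun z (_ : z ∈ D) => ‖ψ z‖ₑ) z hz)
        (blochQ_le_blochBeta hz)
    · refine (mul_le_mul_left (hval z hz) _).trans ?_
      rw [add_mul, mul_right_comm]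
      gcongr
      · exact blochQ_le_blochBeta hz
      · exact le_iSup₂ (f := fun z (_ : z ∈ D) => growth ι z * blochQ D ψ z) z hz
  calc blochENorm D (ι (T x))
      ≤ ‖ψ 0‖ₑ * ‖a‖ₑ + (supENorm D ψ * blochBeta D (ι x) +
        (‖a‖ₑ * blochBeta D ψ + S * blochBeta D (ι x))) := by
        rw [blochENorm, hT x 0 h0, enorm_mul]
        gcongr
    -- The terms |ψ(0)| and β_ψ multiplying `‖a‖ₑ` recombine into the Bloch norm of `ψ`; this is why
    -- the bound is a maximum and not a sum.
    _ = blochENorm D ψ * ‖a‖ₑ + (supENorm D ψ + S) * blochBeta D (ι x) := by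
        rw [blochENorm]; ring
    _ ≤ M * ‖a‖ₑ + M * blochBeta D (ι x) := by
        gcongr
        · exact le_max_left _ _
        · exact le_max_right _ _
    _ = M * blochENorm D (ι x) := by rw [blochENorm, mul_add]

theorem multiplier_norm_estimates (hD : IsBoundedHomogeneousDomain D) (h0 : (0 : Cn n) ∈ D)
    (hψ : IsHolomorphic D ψ) {e : X} (he : ι e = blochOne hD.isOpen)
    (hT : ∀ x, ∀ z ∈ D, ι (T x) z = ψ z * ι x z) :
    ⨆ z ∈ D, growth ι z * blochQ D ψ z < ∞ ∧
      max (blochENorm D ψ) (supENorm D ψ) ≤ ENNReal.ofReal ‖T‖ ∧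
      ENNReal.ofReal ‖T‖ ≤
        max (blochENorm D ψ) (supENorm D ψ + ⨆ z ∈ D, growth ι z * blochQ D ψ z) := by
  have hsup := supENorm_le_opNorm hD h0 he hT
  exact ⟨(iSup_growth_mul_blochQ_le hD hψ hsup hT).trans_lt
    (ENNReal.add_lt_top.2 ⟨ENNReal.ofReal_lt_top, ENNReal.ofReal_lt_top⟩),
    max_le (blochENorm_le_opNorm hD.isOpen h0 he hT) hsup, ofReal_opNorm_le hD h0 hψ he hT⟩

end Multiplier

end BlochMul

theorem mainTheorem2 (n : ℕ) (D : Set (BlochMul.Cn n))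
    (hD : BlochMul.IsBoundedHomogeneousDomain D) (h0 : (0 : BlochMul.Cn n) ∈ D)
    (ψ : BlochMul.Cn n → ℂ) (hψ : BlochMul.IsHolomorphic D ψ) :
    (∀ T : BlochMul.BlochSpace D →L[ℂ] BlochMul.BlochSpace D, BlochMul.IsMulOp D ψ T →
      BlochMul.sigma D ψ < ∞ ∧
      max (BlochMul.blochENorm D ψ) (BlochMul.supENorm D ψ) ≤ ENNReal.ofReal ‖T‖ ∧
      ENNReal.ofReal ‖T‖ ≤
        max (BlochMul.blochENorm D ψ) (BlochMul.supENorm D ψ + BlochMul.sigma D ψ)) ∧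
    (∀ T : BlochMul.starLittleBloch D →L[ℂ] BlochMul.starLittleBloch D,
      BlochMul.IsStarMulOp D ψ T →
      BlochMul.sigmaZero D ψ < ∞ ∧
      max (BlochMul.blochENorm D ψ) (BlochMul.supENorm D ψ) ≤ ENNReal.ofReal ‖T‖ ∧
      ENNReal.ofReal ‖T‖ ≤
        max (BlochMul.blochENorm D ψ) (BlochMul.supENorm D ψ + BlochMul.sigmaZero D ψ)) := by
  refine ⟨fun T hT => ?_, fun T hT => ?_⟩
  · exact BlochMul.multiplier_norm_estimates (ι := LinearIsometry.id) hD h0 hψ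
      (e := BlochMul.blochOne hD.isOpen) rfl hT
  · exact BlochMul.multiplier_norm_estimates (ι := (BlochMul.starLittleBloch D).subtypeₗᵢ) hD h0 hψ
      (e := ⟨_, BlochMul.blochOne_mem_starLittleBloch hD.isOpen⟩) rfl hT
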